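/- Let $A$ be a free group with a finite free basis, let $T$ be the Cayley graph of $A$ with respect to this basis (the metric tree with vertex set $A$ and edges of length $1$ joining $a$ to $ax$ for $x$ in the basis, on which $A$ acts by left multiplication), let $B$ be a group and $\varphi\colon A\to\mathrm{Aut}(B)$ a homomorphism such that $G=B\rtimes_\varphi A$ is finitely generated, and let $\rho$ be the isometric action of $G$ on $T$ obtained from the action of $A$ through the projection $G\to A$. For a geodesic ray $\tau\colon[0,\infty)\to T$ with end point $\tau(\infty)\in\partial T$ and for $t\in\mathbb R$, let $$HB_t(\tau)=\bigcup_{l\ge\max\{0,t\}}\{p\in T : d(p,\tau(l))\le l-t\},$$ and for $k\in\mathbb Z$ let $A_k(\tau)\subseteq A$ be the set of vertices of $T$ lying in $HB_k(\tau)$. The set $\Sigma^1(\rho)\subseteq\partial T$ consists of the end points over which $\rho$ is controlled connected. Here $\rho$ is controlled connected over $\tau(\infty)$ if the following holds for the universal cover $\tilde X$ of a $K(G,1)$-complex such that the $1$-skeleton $\tilde X^{(1)}$ is cocompact, and for a continuous $G$-map $h\colon\tilde X^{(1)}\to T$ (the condition does not depend on the choice of $\tilde X$, of $h$, or of the ray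 $\tau$ representing the end point, and may be required for all choices): writing $\tilde X_{(\tau,t)}$ for the largest subcomplex of $\tilde X^{(1)}$ contained in $h^{-1}(HB_t(\tau))$, there is a function $\lambda\colon\mathbb R\to[0,\infty)$ with $t-\lambda(t)\to\infty$ as $t\to\infty$ such that, for all $t\in\mathbb R$, any two points of $\tilde X_{(\tau,t)}$ can be joined by a path in $\tilde X_{(\tau,t-\lambda(t))}$. Then, for every geodesic ray $\tau$ in $T$: if $\varphi(A_k(\tau))=\varphi(A)$ for all integers $k\ge 0$, then $\tau(\infty)\in\Sigma^1(\rho)$. -/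

import Mathlib

open Topology

universe u v w

/-! ### Geodesic rays, the boundary at infinity, horoballs -/

section Boundary

variable {M : Type v} [MetricSpace M]

/-- A geodesic ray in `M`: an isometric embedding of `[0, ∞)`. -/
structure GeodesicRay (M : Type v) [MetricSpace M] where
  toFun : NNReal → M
  isometry' : Isometry toFun

instance : CoeFun (GeodesicRay M) (fun _ => NNReal → M) := ⟨GeodesicRay.toFun⟩

/-- Two rays are asymptotic if they stay at bounded distance from each other. -/
def GeodesicRay.Asymptotic (τ σ : GeodesicRay M) : Prop :=
  ∃ C : ℝ, ∀ s : NNReal, dist (τ s) (σ s) ≤ C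

instance GeodesicRay.setoid (M : Type v) [MetricSpace M] : Setoid (GeodesicRay M) where
  r := GeodesicRay.Asymptotic
  iseqv :=
    { refl := fun τ => ⟨0, fun s => by simp⟩
      symm := fun ⟨C, hC⟩ => ⟨C, fun s => by rw [dist_comm]; exact hC s⟩
      trans := fun ⟨C, hC⟩ ⟨D, hD⟩ =>
        ⟨C + D, fun s => (dist_triangle _ _ _).trans (add_le_add (hC s) (hD s))⟩ }

/-- The boundary at infinity `∂M`: asymptoty classes of geodesic rays. -/
def BoundaryAtInfinity (M : Type v) [MetricSpace M] : Type v :=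
  Quotient (GeodesicRay.setoid M)

/-- The end point `τ(∞) ∈ ∂M` of a geodesic ray. -/
def GeodesicRay.endpoint (τ : GeodesicRay M) : BoundaryAtInfinity M :=
  Quotient.mk (GeodesicRay.setoid M) τ

/-- The horoball `HB_t(τ)`: the nested union of the closed balls of radius `l - t` about `τ(l)`,
over `l ≥ max {0, t}`. As `t` increases, the horoballs shrink towards `τ(∞)`. -/
def horoball (τ : GeodesicRay M) (t : ℝ) : Set M :=
  ⋃ (l : NNReal) (_ : t ≤ (l : ℝ)), Metric.closedBall (τ l) ((l : ℝ) - t)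

end Boundary

/-! ### Controlled connectivity and `Σ¹(ρ)` -/

section Sigma

/-- `X` is a contractible free `G`-CW-complex with cocompact 1-skeleton; in other words, `X` is
the universal cover, with `G` acting by deck transformations, of a `K(G,1)`-complex
(whose 1-skeleton is finite). -/
structure IsUniversalCoverKG1 (G : Type u) [Group G] (X : Type u) [TopologicalSpace X]
    [T2Space X] [CWComplex (Set.univ : Set X)] [MulAction G X] : Prop where
  contractible : ContractibleSpace X
  continuous_smul : ∀ g : G, Continuous fun x : X => g • x
  /-- The action permutes the open cells in each dimension. -/
  smul_openCell : ∀ (g : G) (n : ℕ) (i : RelCWComplex.cell (Set.univ : Set X) n),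
    ∃ j : RelCWComplex.cell (Set.univ : Set X) n,
      (fun x : X => g • x) '' RelCWComplex.openCell n i = RelCWComplex.openCell n j
  /-- The action on the set of cells is free. -/
  free : ∀ (g : G) (n : ℕ) (i : RelCWComplex.cell (Set.univ : Set X) n),
    (fun x : X => g • x) '' RelCWComplex.openCell n i = RelCWComplex.openCell n i → g = 1
  /-- The 1-skeleton is cocompact. -/
  cocompact : ∃ K : Set X, IsCompact K ∧
    (RelCWComplex.skeleton (Set.univ : Set X) 1 : Set X) = ⋃ g : G, (fun x : X => g • x) '' K

/-- `h` (of which only the values on the 1-skeleton of `X` matter) restricts to a continuous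
`G`-map from the 1-skeleton of `X` to `M`, where `G` acts on `M` through `ρ`. -/
structure IsControlMap {G : Type u} [Group G] {M : Type v} [MetricSpace M] (ρ : G →* (M ≃ᵢ M))
    (X : Type u) [TopologicalSpace X] [T2Space X] [CWComplex (Set.univ : Set X)] [MulAction G X]
    (h : X → M) : Prop where
  continuousOn : ContinuousOn h (RelCWComplex.skeleton (Set.univ : Set X) 1 : Set X)
  equivariant : ∀ (g : G), ∀ x ∈ (RelCWComplex.skeleton (Set.univ : Set X) 1 : Set X),
    h (g • x) = ρ g (h x)

variable {M : Type v} [MetricSpace M]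

/-- `X_(τ,t)`: the largest subcomplex of the 1-skeleton of `X` contained in `h⁻¹(HB_t(τ))`, that
is, the union of all such subcomplexes. -/
def horoballSubcomplex {X : Type u} [TopologicalSpace X] [T2Space X] [CWComplex (Set.univ : Set X)]
    (h : X → M) (τ : GeodesicRay M) (t : ℝ) : Set X :=
  ⋃ (E : RelCWComplex.Subcomplex (Set.univ : Set X))
    (_ : (E : Set X) ⊆ (RelCWComplex.skeleton (Set.univ : Set X) 1 : Set X) ∩
      h ⁻¹' horoball τ t), (E : Set X)

/-- `h` is controlled connected over `τ(∞)`, with lag `lag`. -/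
def IsControlledConnected {X : Type u} [TopologicalSpace X] [T2Space X] [CWComplex (Set.univ : Set X)]
    (h : X → M) (τ : GeodesicRay M) : Prop :=
  ∃ lag : ℝ → ℝ, (∀ t, 0 ≤ lag t) ∧
    (∀ t : ℝ, ∀ x ∈ horoballSubcomplex h τ t, ∀ y ∈ horoballSubcomplex h τ t,
      JoinedIn (horoballSubcomplex h τ (t - lag t)) x y) ∧
    Filter.Tendsto (fun t => t - lag t) Filter.atTop Filter.atTop

/-- The invariant `Σ¹(ρ) ⊆ ∂M` of an isometric action `ρ` of a finitely generated group `G` on a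
proper CAT(0) space `M`: the end points over which `ρ` is controlled connected. Controlled
connectivity does not depend on the choice of the complex `X`, the control map `h` and the ray `τ`
representing `e`; it is required here for every choice (choices exist, as a finitely generated
group has a `K(G,1)` with finite 1-skeleton, and `M` is contractible). -/
def SigmaOne {G : Type u} [Group G] (ρ : G →* (M ≃ᵢ M)) : Set (BoundaryAtInfinity M) :=
  {e | ∀ (X : Type u) [TopologicalSpace X] [T2Space X] [CWComplex (Set.univ : Set X)]
    [MulAction G X], IsUniversalCoverKG1 G X →
    ∀ h : X → M, IsControlMap ρ X h →
    ∀ τ : GeodesicRay M, τ.endpoint = e → IsControlledConnected h τ}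

end Sigma

/-! ### The geometric realization of a connected graph -/

section Realization

variable {V : Type v}

/-- The point of the closed oriented edge `[src, tgt]` (of length 1) at distance `pos` from `src`;
degenerate edges (`src = tgt`, of length 0) are allowed, and give the vertices. -/
structure EdgePoint (Γ : SimpleGraph V) where
  src : V
  tgt : V
  eq_or_adj : src = tgt ∨ Γ.Adj src tgt
  pos : ℝ
  pos_nonneg : 0 ≤ pos
  pos_le : pos ≤ (Γ.dist src tgt : ℝ)

namespace EdgePoint

variable {Γ : SimpleGraph V}

/-- The length of the shortest path from `p` to `q` through the ends of their edges. -/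
noncomputable def detour (p q : EdgePoint Γ) : ℝ :=
  min
    (min (p.pos + Γ.dist p.src q.src + q.pos)
      (p.pos + Γ.dist p.src q.tgt + (Γ.dist q.src q.tgt - q.pos)))
    (min ((Γ.dist p.src p.tgt - p.pos) + Γ.dist p.tgt q.src + q.pos)
      ((Γ.dist p.src p.tgt - p.pos) + Γ.dist p.tgt q.tgt + (Γ.dist q.src q.tgt - q.pos)))

open Classical in
/-- The path metric: the distance along the edge for points of a common edge, and the length of
a shortest path through the ends of the edges otherwise. -/
noncomputable def pathDist (p q : EdgePoint Γ) : ℝ :=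
  if p.src = q.src ∧ p.tgt = q.tgt then |p.pos - q.pos|
  else if p.src = q.tgt ∧ p.tgt = q.src then |p.pos - (Γ.dist q.src q.tgt - q.pos)|
  else detour p q

/-- `p` is at distance `c` from the end `x` of its edge. -/
def End (p : EdgePoint Γ) (x : V) (c : ℝ) : Prop :=
  (x = p.src ∧ c = p.pos) ∨ (x = p.tgt ∧ c = Γ.dist p.src p.tgt - p.pos)

theorem detour_le (p q : EdgePoint Γ) {x y : V} {c d : ℝ} (hx : p.End x c) (hy : q.End y d) :
    p.detour q ≤ c + Γ.dist x y + d := by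
  rcases hx with ⟨rfl, rfl⟩ | ⟨rfl, rfl⟩ <;> rcases hy with ⟨rfl, rfl⟩ | ⟨rfl, rfl⟩ <;>
    simp [detour]

theorem exists_detour_eq (p q : EdgePoint Γ) :
    ∃ x y c d, p.End x c ∧ q.End y d ∧ p.detour q = c + Γ.dist x y + d := by
  rcases min_choice
    (min (p.pos + Γ.dist p.src q.src + q.pos)
      (p.pos + Γ.dist p.src q.tgt + (Γ.dist q.src q.tgt - q.pos)))
    (min ((Γ.dist p.src p.tgt - p.pos) + Γ.dist p.tgt q.src + q.pos)
      ((Γ.dist p.src p.tgt - p.pos) + Γ.dist p.tgt q.tgt + (Γ.dist q.src q.tgt - q.pos))) with h | h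
  · rcases min_choice (p.pos + Γ.dist p.src q.src + q.pos)
      (p.pos + Γ.dist p.src q.tgt + (Γ.dist q.src q.tgt - q.pos)) with h' | h'
    · exact ⟨_, _, _, _, Or.inl ⟨rfl, rfl⟩, Or.inl ⟨rfl, rfl⟩, h.trans h'⟩
    · exact ⟨_, _, _, _, Or.inl ⟨rfl, rfl⟩, Or.inr ⟨rfl, rfl⟩, h.trans h'⟩
  · rcases min_choice ((Γ.dist p.src p.tgt - p.pos) + Γ.dist p.tgt q.src + q.pos)
      ((Γ.dist p.src p.tgt - p.pos) + Γ.dist p.tgt q.tgt + (Γ.dist q.src q.tgt - q.pos)) with h' | h'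
    · exact ⟨_, _, _, _, Or.inr ⟨rfl, rfl⟩, Or.inl ⟨rfl, rfl⟩, h.trans h'⟩
    · exact ⟨_, _, _, _, Or.inr ⟨rfl, rfl⟩, Or.inr ⟨rfl, rfl⟩, h.trans h'⟩

theorem End.nonneg {p : EdgePoint Γ} {x : V} {c : ℝ} (h : p.End x c) : 0 ≤ c := by
  rcases h with ⟨rfl, rfl⟩ | ⟨rfl, rfl⟩
  · exact p.pos_nonneg
  · linarith [p.pos_le]

theorem End.dist_le {p : EdgePoint Γ} {x y : V} {c d : ℝ} (hx : p.End x c) (hy : p.End y d) :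
    (Γ.dist x y : ℝ) ≤ c + d := by
  have h0 := hx.nonneg
  have h1 := hy.nonneg
  rcases hx with ⟨rfl, rfl⟩ | ⟨rfl, rfl⟩ <;> rcases hy with ⟨rfl, rfl⟩ | ⟨rfl, rfl⟩
  · simpa using h0
  · linarith
  · rw [SimpleGraph.dist_comm]; linarith
  · simp only [SimpleGraph.dist_self, Nat.cast_zero]; linarith

/-- `p` and `q` lie on the same edge, at distance `r` along this edge. -/
def Same (p q : EdgePoint Γ) (r : ℝ) : Prop :=
  (p.src = q.src ∧ p.tgt = q.tgt ∧ r = |p.pos - q.pos|) ∨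
    (p.src = q.tgt ∧ p.tgt = q.src ∧ r = |p.pos - (Γ.dist q.src q.tgt - q.pos)|)

theorem Same.symm {p q : EdgePoint Γ} {r : ℝ} (h : p.Same q r) : q.Same p r := by
  rcases h with ⟨h1, h2, h3⟩ | ⟨h1, h2, h3⟩
  · exact Or.inl ⟨h1.symm, h2.symm, by rw [h3, abs_sub_comm]⟩
  · refine Or.inr ⟨h2.symm, h1.symm, ?_⟩
    rw [h3, h1, h2, SimpleGraph.dist_comm]
    congr 1; ring

theorem Same.exists_end {p q : EdgePoint Γ} {r : ℝ} (h : p.Same q r) {x : V} {d : ℝ}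
    (hx : q.End x d) : ∃ c, p.End x c ∧ c ≤ r + d := by
  rcases h with ⟨h1, h2, rfl⟩ | ⟨h1, h2, rfl⟩ <;> rcases hx with ⟨rfl, rfl⟩ | ⟨rfl, rfl⟩
  · exact ⟨_, Or.inl ⟨h1.symm, rfl⟩, by linarith [le_abs_self (p.pos - q.pos)]⟩
  · refine ⟨_, Or.inr ⟨h2.symm, rfl⟩, ?_⟩
    rw [h1, h2]; linarith [neg_abs_le (p.pos - q.pos)]
  · refine ⟨_, Or.inr ⟨h2.symm, rfl⟩, ?_⟩
    rw [h1, h2, SimpleGraph.dist_comm]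
    linarith [neg_abs_le (p.pos - (Γ.dist q.src q.tgt - q.pos))]
  · exact ⟨_, Or.inl ⟨h1.symm, rfl⟩,
      by linarith [le_abs_self (p.pos - (Γ.dist q.src q.tgt - q.pos))]⟩

theorem Same.trans {p q s : EdgePoint Γ} {r t : ℝ} (h : p.Same q r) (h' : q.Same s t) :
    ∃ r', p.Same s r' ∧ r' ≤ r + t := by
  rcases h with ⟨h1, h2, rfl⟩ | ⟨h1, h2, rfl⟩ <;>
    rcases h' with ⟨h3, h4, rfl⟩ | ⟨h3, h4, rfl⟩
  · exact ⟨_, Or.inl ⟨h1.trans h3, h2.trans h4, rfl⟩, abs_sub_le _ _ _⟩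
  · exact ⟨_, Or.inr ⟨h1.trans h3, h2.trans h4, rfl⟩, abs_sub_le _ _ _⟩
  · refine ⟨_, Or.inr ⟨h1.trans h4, h2.trans h3, rfl⟩, ?_⟩
    rw [h3, h4]
    refine (abs_sub_le _ (Γ.dist s.src s.tgt - q.pos) _).trans (add_le_add le_rfl (le_of_eq ?_))
    rw [abs_sub_comm]; congr 1; ring
  · refine ⟨_, Or.inl ⟨h1.trans h4, h2.trans h3, rfl⟩, ?_⟩
    rw [h3, h4, SimpleGraph.dist_comm]
    refine (abs_sub_le _ (Γ.dist s.src s.tgt - q.pos) _).trans (add_le_add le_rfl (le_of_eq ?_))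
    rw [abs_sub_comm]; congr 1; ring

/-- Two points on the same edge, in either orientation: distances along the edge agree. -/
theorem Same.unique {p q : EdgePoint Γ} {r t : ℝ} (h : p.Same q r) (h' : p.Same q t) : r = t := by
  have hp := p.pos_nonneg
  have hp' := p.pos_le
  have hq := q.pos_nonneg
  have hq' := q.pos_le
  rcases h with ⟨h1, h2, rfl⟩ | ⟨h1, h2, rfl⟩ <;>
    rcases h' with ⟨h3, h4, rfl⟩ | ⟨h3, h4, rfl⟩
  · rfl
  · have : q.src = q.tgt := h1.symm.trans h3
    rw [h1, h2] at hp'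
    simp only [this, SimpleGraph.dist_self, Nat.cast_zero] at *
    rw [le_antisymm hp' hp, le_antisymm hq' hq]; simp
  · have : q.src = q.tgt := h3.symm.trans h1
    rw [h3, h4] at hp'
    simp only [this, SimpleGraph.dist_self, Nat.cast_zero] at *
    rw [le_antisymm hp' hp, le_antisymm hq' hq]; simp
  · rfl

theorem Same.le_detour {p q : EdgePoint Γ} {r : ℝ} (h : p.Same q r) : r ≤ p.detour q := by
  obtain ⟨x, y, c, d, hx, hy, he⟩ := exists_detour_eq p q
  rw [he]
  have hp := p.pos_nonneg
  have hp' := p.pos_le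
  have hq := q.pos_nonneg
  have hq' := q.pos_le
  rcases h with ⟨h1, h2, rfl⟩ | ⟨h1, h2, rfl⟩ <;> rw [h1, h2] at hp' <;>
    rcases hx with ⟨rfl, rfl⟩ | ⟨rfl, rfl⟩ <;> rcases hy with ⟨rfl, rfl⟩ | ⟨rfl, rfl⟩ <;>
    simp only [h1, h2, SimpleGraph.dist_self, Nat.cast_zero] <;>
    (try rw [SimpleGraph.dist_comm (u := q.tgt) (v := q.src)] at *) <;>
    rw [abs_le] <;> constructor <;> linarith

theorem pathDist_eq_of_same {p q : EdgePoint Γ} {r : ℝ} (h : p.Same q r) : pathDist p q = r := by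
  unfold pathDist
  split_ifs with h1 h2
  · exact Same.unique (Or.inl ⟨h1.1, h1.2, rfl⟩) h
  · exact Same.unique (Or.inr ⟨h2.1, h2.2, rfl⟩) h
  · rcases h with h | h
    · exact absurd ⟨h.1, h.2.1⟩ h1
    · exact absurd ⟨h.1, h.2.1⟩ h2

theorem pathDist_cases (p q : EdgePoint Γ) :
    p.Same q (pathDist p q) ∨ pathDist p q = detour p q := by
  unfold pathDist
  split_ifs with h1 h2
  · exact Or.inl (Or.inl ⟨h1.1, h1.2, rfl⟩)
  · exact Or.inl (Or.inr ⟨h2.1, h2.2, rfl⟩)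
  · exact Or.inr rfl

theorem pathDist_le_detour (p q : EdgePoint Γ) : pathDist p q ≤ detour p q := by
  rcases pathDist_cases p q with h | h
  · exact h.le_detour
  · exact h.le

theorem detour_comm (p q : EdgePoint Γ) : detour p q = detour q p := by
  have key : ∀ p q : EdgePoint Γ, detour p q ≤ detour q p := fun p q => by
    obtain ⟨x, y, c, d, hx, hy, he⟩ := exists_detour_eq q p
    rw [he]
    have := detour_le p q hy hx
    rw [SimpleGraph.dist_comm] at this
    linarith
  exact le_antisymm (key p q) (key q p)

theorem pathDist_self (p : EdgePoint Γ) : pathDist p p = 0 :=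
  pathDist_eq_of_same (Or.inl ⟨rfl, rfl, by simp⟩)

theorem pathDist_comm (p q : EdgePoint Γ) : pathDist p q = pathDist q p := by
  rcases pathDist_cases p q with h | h
  · exact (pathDist_eq_of_same h.symm).symm
  · rcases pathDist_cases q p with h' | h'
    · exact pathDist_eq_of_same h'.symm
    · rw [h, h', detour_comm]

theorem pathDist_triangle (hΓ : Γ.Connected) (p q s : EdgePoint Γ) :
    pathDist p s ≤ pathDist p q + pathDist q s := by
  have tri : ∀ x y z : V, (Γ.dist x z : ℝ) ≤ Γ.dist x y + Γ.dist y z := fun x y z => by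
    exact_mod_cast hΓ.dist_triangle
  rcases pathDist_cases p q with h | h <;> rcases pathDist_cases q s with h' | h'
  · obtain ⟨r, hr, hle⟩ := h.trans h'
    rw [pathDist_eq_of_same hr]; exact hle
  · obtain ⟨x, y, c, d, hx, hy, he⟩ := exists_detour_eq q s
    obtain ⟨c', hx', hle⟩ := h.exists_end hx
    have := (pathDist_le_detour p s).trans (detour_le p s hx' hy)
    linarith
  · obtain ⟨x, y, c, d, hx, hy, he⟩ := exists_detour_eq p q
    obtain ⟨d', hy', hle⟩ := h'.symm.exists_end hy
    have := (pathDist_le_detour p s).trans (detour_le p s hx hy')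
    linarith
  · obtain ⟨x, y, c, d, hx, hy, he⟩ := exists_detour_eq p q
    obtain ⟨x', y', c', d', hx', hy', he'⟩ := exists_detour_eq q s
    have h1 := (pathDist_le_detour p s).trans (detour_le p s hx hy')
    have h2 := hy.dist_le hx'
    linarith [tri x y y', tri y x' y']

/-- Isometric reparametrization of points along a graph automorphism. -/
theorem pathDist_congr {p q p' q' : EdgePoint Γ} (f : V ≃ V)
    (hf : ∀ x y, Γ.dist (f x) (f y) = Γ.dist x y)
    (hp : p'.src = f p.src ∧ p'.tgt = f p.tgt ∧ p'.pos = p.pos)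
    (hq : q'.src = f q.src ∧ q'.tgt = f q.tgt ∧ q'.pos = q.pos) :
    pathDist p' q' = pathDist p q := by
  classical
  unfold pathDist detour
  refine if_congr ?_ ?_ (if_congr ?_ ?_ ?_) <;>
    simp only [hp.1, hp.2.1, hp.2.2, hq.1, hq.2.1, hq.2.2, hf, EmbeddingLike.apply_eq_iff_eq]

noncomputable instance pseudoMetricSpace [hΓ : Fact Γ.Connected] :
    PseudoMetricSpace (EdgePoint Γ) where
  dist := pathDist
  dist_self := pathDist_self
  dist_comm := pathDist_comm
  dist_triangle := pathDist_triangle hΓ.out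

end EdgePoint

/-- The geometric realization of a connected graph `Γ`, all edges having length 1, with its path
metric: points of edges are identified when they are at distance zero. -/
abbrev GeometricRealization (Γ : SimpleGraph V) [Fact Γ.Connected] : Type v :=
  SeparationQuotient (EdgePoint Γ)

/-- The vertex `x`, as a point of the geometric realization. -/
noncomputable def vertexPoint (Γ : SimpleGraph V) [Fact Γ.Connected] (x : V) : GeometricRealization Γ :=
  SeparationQuotient.mk ⟨x, x, Or.inl rfl, 0, le_rfl, by simp⟩

end Realization

/-! ### The Cayley tree of a free group, and the action of `B ⋊ A` on it -/

section CayleyTree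

variable {ι : Type w} {A : Type u} [Group A]

/-- The Cayley graph of `A` with respect to a free basis: `a` is joined to `a * b i`. -/
abbrev cayleyGraph (b : FreeGroupBasis ι A) : SimpleGraph A :=
  SimpleGraph.mulCayley (Set.range b)

theorem cayleyGraph_connected (b : FreeGroupBasis ι A) : (cayleyGraph b).Connected := by
  have hstep : ∀ (a : A) (i : ι), (cayleyGraph b).Reachable a (a * b i) := by
    intro a i
    by_cases h : a = a * b i
    · rw [← h]
    · refine SimpleGraph.Adj.reachable ?_
      rw [SimpleGraph.mulCayley_adj']
      exact ⟨h, b i, ⟨i, rfl⟩, Or.inl rfl⟩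
  have hfree : ∀ (x : FreeGroup ι) (a : A), (cayleyGraph b).Reachable a (a * b.repr.symm x) := by
    intro x
    induction x using FreeGroup.induction_on with
    | C1 => intro a; simp
    | of i => intro a; exact hstep a i
    | inv_of i _ =>
      intro a
      have := hstep (a * b.repr.symm (FreeGroup.of i)⁻¹) i
      have e : a * b.repr.symm (FreeGroup.of i)⁻¹ * b i = a := by
        have : b i = b.repr.symm (FreeGroup.of i) := rfl
        rw [this, map_inv, inv_mul_cancel_right]
      rw [e] at this
      exact this.symm
    | mul x y hx hy =>
      intro a
      rw [map_mul, ← mul_assoc]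
      exact (hx a).trans (hy _)
  have : Nonempty A := ⟨1⟩
  refine SimpleGraph.Connected.mk fun x y => ?_
  simpa using hfree (b.repr (x⁻¹ * y)) x

instance (b : FreeGroupBasis ι A) : Fact (cayleyGraph b).Connected :=
  ⟨cayleyGraph_connected b⟩

/-- The Cayley tree `T` of `A` with respect to the free basis `b`, as a metric space. -/
abbrev CayleyTree (b : FreeGroupBasis ι A) : Type u := GeometricRealization (cayleyGraph b)

theorem cayleyGraph_dist_mul (b : FreeGroupBasis ι A) (a x y : A) :
    (cayleyGraph b).dist (a * x) (a * y) = (cayleyGraph b).dist x y := by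
  have key : ∀ a x y : A, (cayleyGraph b).dist (a * x) (a * y) ≤ (cayleyGraph b).dist x y := by
    intro a x y
    obtain ⟨p, hp⟩ := (cayleyGraph_connected b).exists_walk_length_eq_dist x y
    let f : cayleyGraph b →g cayleyGraph b :=
      ⟨fun z => a * z, fun h => SimpleGraph.mulCayley_adj_mul_iff_right.2 h⟩
    rw [← hp, ← SimpleGraph.Walk.length_map f p]
    exact SimpleGraph.dist_le _
  refine le_antisymm (key a x y) ?_
  simpa using key a⁻¹ (a * x) (a * y)

/-- `A` acts on the points of edges by left multiplication on the ends of the edges. -/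
instance (b : FreeGroupBasis ι A) : MulAction A (EdgePoint (cayleyGraph b)) where
  smul a p :=
    { src := a * p.src
      tgt := a * p.tgt
      eq_or_adj := p.eq_or_adj.imp (congrArg _) SimpleGraph.mulCayley_adj_mul_iff_right.2
      pos := p.pos
      pos_nonneg := p.pos_nonneg
      pos_le := by rw [cayleyGraph_dist_mul]; exact p.pos_le }
  one_smul p := by
    cases p
    simp only [HSMul.hSMul, one_mul]
  mul_smul a a' p := by
    cases p
    simp only [HSMul.hSMul, mul_assoc]

instance (b : FreeGroupBasis ι A) : IsIsometricSMul A (EdgePoint (cayleyGraph b)) where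
  isometry_smul a := Isometry.of_dist_eq fun p q =>
    EdgePoint.pathDist_congr (p := p) (q := q) (Equiv.mulLeft a) (cayleyGraph_dist_mul b a)
      ⟨rfl, rfl, rfl⟩ ⟨rfl, rfl, rfl⟩

instance (b : FreeGroupBasis ι A) : IsIsometricSMul A (CayleyTree b) where
  isometry_smul a := Isometry.of_dist_eq fun p q => by
    obtain ⟨p, rfl⟩ := SeparationQuotient.surjective_mk p
    obtain ⟨q, rfl⟩ := SeparationQuotient.surjective_mk q
    exact dist_smul a p q

/-- The action of `A` on its Cayley tree by isometries, induced by left multiplication. -/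
noncomputable def cayleyTreeAction (b : FreeGroupBasis ι A) :
    A →* (CayleyTree b ≃ᵢ CayleyTree b) where
  toFun a := IsometryEquiv.constSMul a
  map_one' := by ext p; exact one_smul A p
  map_mul' a a' := by ext p; exact mul_smul a a' p

/-- The action `ρ` of `G = B ⋊ A` on the Cayley tree of `A` through the projection `G → A`. -/
noncomputable def semidirectTreeAction {B : Type w} [Group B] (φ : A →* MulAut B)
    {κ : Type v} (b : FreeGroupBasis κ A) :
    B ⋊[φ] A →* (CayleyTree b ≃ᵢ CayleyTree b) :=
  (cayleyTreeAction b).comp SemidirectProduct.rightHom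

/-- `A_k(τ)`: the elements of `A` that are vertices of the horoball `HB_k(τ)`. -/
def horoballVertices (b : FreeGroupBasis ι A) (τ : GeodesicRay (CayleyTree b)) (k : ℤ) : Set A :=
  {a | vertexPoint (cayleyGraph b) a ∈ horoball τ (k : ℝ)}

end CayleyTree

/-! Write an element of `B ⋊ A` as a pair `(x, a)`; it sits over the vertex `a` of the tree. Right
multiplication by a basis element `b i` moves `a` along an edge and keeps `x`, while right
multiplication by `s ∈ B` turns `(x, a)` into `(x * φ a s, a)`. Since the group is finitely
generated, finitely many elements `s ∈ F` have `A`-orbits generating `B`. To multiply `x` by `φ c s`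
while staying over a horoball, choose `a'` in the horoball with `φ a' = φ c`, which the hypothesis
permits at every depth: walk from `a` to `a'` in the tree, apply `s`, and walk back. Horoballs in
the tree are connected up to a shift by 2, so any two group elements over `HB_t` are joined in the
Cayley graph over `HB_{t-2}`. This is `eqvGen_horoballStep`.

`isControlledConnected_of_eqvGen` carries this over to an arbitrary complex `X` and control map `h`.
Cocompactness moves every point to a translate of a base point, and an edge of the Cayley graph
becomes a translate of one of finitely many paths in the 1-skeleton, so each costs bounded depth.
Such paths exist because the 1-skeleton of the contractible space `X` is connected through edges
(`reflTransGen_inCommonEdge`). The resulting lag is constant. -/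

/-! ### Connectedness of the 1-skeleton of a CW-complex. -/

section CellStructure

variable {X : Type u} [TopologicalSpace X] [CWComplex (Set.univ : Set X)]

/-- The smallest set containing `P` and every open cell of dimension at least two whose frontier
it contains. -/
inductive CellHull (P : Set X) : X → Prop
  | base (x : X) : x ∈ P → CellHull P x
  | step (n : ℕ) (hn : 2 ≤ n) (e : RelCWComplex.cell (Set.univ : Set X) n)
      (h : ∀ y ∈ RelCWComplex.cellFrontier n e, CellHull P y) (x : X) :
      x ∈ RelCWComplex.openCell n e → CellHull P x

/-- Distinct open cells are disjoint, so a point of `e` not in `P` can only have entered the hull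
through `e` itself. -/
theorem CellHull.mem_or_frontier {P : Set X} {n : ℕ} {e : RelCWComplex.cell (Set.univ : Set X) n}
    {x : X} (hx : x ∈ RelCWComplex.openCell n e) (h : CellHull P x) :
    x ∈ P ∨ 2 ≤ n ∧ ∀ y ∈ RelCWComplex.cellFrontier n e, CellHull P y := by
  cases h with
  | base _ h => exact Or.inl h
  | step m hm e' h _ hx' =>
    have := RelCWComplex.eq_of_not_disjoint_openCell
      (Set.not_disjoint_iff.2 ⟨x, hx, hx'⟩)
    cases this
    exact Or.inr ⟨hm, h⟩

/-- The boundary sphere of a disc of dimension at least two is connected. This is why `CellHull`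
attaches only such cells. -/
theorem isPreconnected_cellFrontier {n : ℕ} (hn : 2 ≤ n)
    (e : RelCWComplex.cell (Set.univ : Set X) n) :
    IsPreconnected (RelCWComplex.cellFrontier n e) := by
  refine (isPreconnected_sphere ?_ 0 1).image _
    ((RelCWComplex.continuousOn n e).mono Metric.sphere_subset_closedBall)
  rw [rank_fin_fun]
  exact_mod_cast hn

theorem isPathConnected_closedCell (n : ℕ) (e : RelCWComplex.cell (Set.univ : Set X) n) :
    IsPathConnected (RelCWComplex.closedCell n e) :=
  ((convex_closedBall (0 : Fin n → ℝ) 1).isPathConnected ⟨0, by simp⟩).image'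
    (RelCWComplex.continuousOn n e)

/-- Every closed cell of dimension at most one contains a vertex. -/
theorem exists_vertex_mem_closedCell {n : ℕ} (hn : n ≤ 1)
    (e : RelCWComplex.cell (Set.univ : Set X) n) :
    ∃ j : RelCWComplex.cell (Set.univ : Set X) 0,
      RelCWComplex.openCell 0 j ⊆ RelCWComplex.closedCell n e := by
  interval_cases n
  · exact ⟨e, RelCWComplex.openCell_subset_closedCell 0 e⟩
  · obtain ⟨a, b, hab⟩ := CWComplex.exists_cellFrontier_one_eq e
    have hsub := RelCWComplex.cellFrontier_subset_closedCell 1 e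
    rw [hab] at hsub
    exact ⟨a, (RelCWComplex.openCell_subset_closedCell 0 a).trans
      (Set.subset_union_left.trans hsub)⟩

variable [T2Space X]

theorem closedCell_subset_skeleton_one {n : ℕ} (hn : n ≤ 1)
    (e : RelCWComplex.cell (Set.univ : Set X) n) :
    RelCWComplex.closedCell n e ⊆ (RelCWComplex.skeleton (Set.univ : Set X) 1 : Set X) :=
  (RelCWComplex.closedCell_subset_skeleton n e).trans
    (RelCWComplex.skeleton_mono (by exact_mod_cast hn))

/-- A separation of the 1-skeleton extends over cells of higher dimension. By induction, the parts
of a frontier in the two hulls are closed, disjoint and cover it. The frontier is connected, so it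
lies in one hull, and that hull then absorbs the open cell. The other hull cannot reach the cell,
since it would have to contain the nonempty frontier. -/
theorem cellHull_closedCell_dichotomy {P Q : Set X} (hPQ : Disjoint P Q)
    (hP : P ⊆ (RelCWComplex.skeleton (Set.univ : Set X) 1 : Set X))
    (hQ : Q ⊆ (RelCWComplex.skeleton (Set.univ : Set X) 1 : Set X))
    (hcell : ∀ n ≤ 1, ∀ e : RelCWComplex.cell (Set.univ : Set X) n,
      RelCWComplex.closedCell n e ⊆ P ∨ RelCWComplex.closedCell n e ⊆ Q) (n : ℕ) :
    ∀ e : RelCWComplex.cell (Set.univ : Set X) n,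
      (RelCWComplex.closedCell n e ⊆ {x | CellHull P x} ∧
        Disjoint (RelCWComplex.closedCell n e) {x | CellHull Q x}) ∨
      (RelCWComplex.closedCell n e ⊆ {x | CellHull Q x} ∧
        Disjoint (RelCWComplex.closedCell n e) {x | CellHull P x}) := by
  induction n using Nat.strong_induction_on with
  | _ n ih =>
  intro e
  have low : ∀ R : Set X, ∀ x ∈ (RelCWComplex.skeleton (Set.univ : Set X) 1 : Set X),
      CellHull R x → x ∈ R := by
    intro R x hx h
    cases h with
    | base _ h => exact h
    | step m hm e' h _ hx' =>
      exact ((RelCWComplex.disjoint_skeleton_openCell (by exact_mod_cast hm)).le_bot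
        ⟨hx, hx'⟩).elim
  have disj : ∀ R : Set X, ∀ {m : ℕ}, 2 ≤ m → ∀ j : RelCWComplex.cell (Set.univ : Set X) m,
      R ⊆ (RelCWComplex.skeleton (Set.univ : Set X) 1 : Set X) →
      ∀ x ∈ RelCWComplex.openCell m j, x ∉ R := fun R m hm j hR x hx hx' =>
    (RelCWComplex.disjoint_skeleton_openCell (by exact_mod_cast hm)).le_bot ⟨hR hx', hx⟩
  rcases Nat.lt_or_ge 1 n with hn | hn
  · obtain ⟨I, hI⟩ := CWComplex.cellFrontier_subset_finite_closedCell n e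
    have hcl : ∀ R : Set X, (∀ m < n, ∀ j : RelCWComplex.cell (Set.univ : Set X) m,
        RelCWComplex.closedCell m j ⊆ {x | CellHull R x} ∨
        Disjoint (RelCWComplex.closedCell m j) {x | CellHull R x}) →
        IsClosed (RelCWComplex.cellFrontier n e ∩ {x | CellHull R x}) := by
      intro R hR
      -- The frontier meets only finitely many lower cells, each wholly inside or wholly outside the
      -- hull, so a finite union of closed cells cuts out this part.
      have : RelCWComplex.cellFrontier n e ∩ {x | CellHull R x} =
          RelCWComplex.cellFrontier n e ∩ ⋃ m ∈ Finset.range n, ⋃ j ∈ I m,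
            (RelCWComplex.closedCell m j ∩ {x | CellHull R x}) := by
        ext x
        refine and_congr_right fun hx => ?_
        have := hI hx
        simp only [Set.mem_iUnion, Set.mem_inter_iff, Finset.mem_range, Set.mem_ofPred_eq,
          exists_prop] at this ⊢
        grind
      rw [this]
      refine RelCWComplex.isClosed_cellFrontier.inter (isClosed_biUnion_finset fun m hm =>
        isClosed_biUnion_finset fun j _ => ?_)
      rcases hR m (Finset.mem_range.1 hm) j with h | h
      · rw [Set.inter_eq_left.2 h]; exact RelCWComplex.isClosed_closedCell
      · rw [h.inter_eq]; exact isClosed_empty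
    have hclP := hcl P fun m hm j => (ih m hm j).imp And.left And.right
    have hclQ := hcl Q fun m hm j => (ih m hm j).symm.imp And.left And.right
    have hFdisj : ∀ x ∈ RelCWComplex.cellFrontier n e, CellHull P x → CellHull Q x → False := by
      intro x hx h h'
      obtain ⟨m, hm, j, -, hxj⟩ := by simpa using hI hx
      rcases ih m hm j with h2 | h2
      · exact h2.2.le_bot ⟨hxj, h'⟩
      · exact h2.2.le_bot ⟨hxj, h⟩
    have hcover : RelCWComplex.cellFrontier n e ⊆
        (RelCWComplex.cellFrontier n e ∩ {x | CellHull P x}) ∪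
        (RelCWComplex.cellFrontier n e ∩ {x | CellHull Q x}) := by
      intro x hx
      obtain ⟨m, hm, j, -, hxj⟩ := by simpa using hI hx
      rcases ih m hm j with h2 | h2
      · exact Or.inl ⟨hx, h2.1 hxj⟩
      · exact Or.inr ⟨hx, h2.1 hxj⟩
    have hne : (RelCWComplex.cellFrontier n e).Nonempty :=
      RelCWComplex.nonempty_cellFrontier (by omega) e
    have concl : ∀ R R' : Set X, R' ⊆ (RelCWComplex.skeleton (Set.univ : Set X) 1 : Set X) →
        (∀ x ∈ RelCWComplex.cellFrontier n e, CellHull R x → CellHull R' x → False) →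
        (∀ x ∈ RelCWComplex.cellFrontier n e, CellHull R x) →
        RelCWComplex.closedCell n e ⊆ {x | CellHull R x} ∧
        Disjoint (RelCWComplex.closedCell n e) {x | CellHull R' x} := by
      intro R R' hR' hd h
      rw [← RelCWComplex.cellFrontier_union_openCell_eq_closedCell]
      refine ⟨Set.union_subset h fun x hx => CellHull.step n hn e h x hx,
        Set.disjoint_left.2 ?_⟩
      rintro x (hx | hx) hx'
      · exact hd x hx (h x hx) hx'
      · rcases hx'.mem_or_frontier hx with h1 | ⟨-, h1⟩
        · exact disj R' hn e hR' x hx h1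
        · obtain ⟨y, hy⟩ := hne
          exact hd y hy (h y hy) (h1 y hy)
    by_cases hex : ∃ x ∈ RelCWComplex.cellFrontier n e, CellHull Q x
    · right
      refine concl Q P hP (fun x hx h h' => hFdisj x hx h' h) fun x hx => ?_
      by_contra hxQ
      have hxP : CellHull P x := ((hcover hx).resolve_right fun h => hxQ h.2).2
      obtain ⟨y, hy, hyQ⟩ := hex
      obtain ⟨z, hz, hz1, hz2⟩ := isPreconnected_closed_iff.1 (isPreconnected_cellFrontier hn e)
        _ _ hclP hclQ hcover ⟨x, hx, hx, hxP⟩ ⟨y, hy, hy, hyQ⟩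
      exact hFdisj z hz hz1.2 hz2.2
    · left
      refine concl P Q hQ hFdisj fun x hx => ?_
      exact ((hcover hx).resolve_right fun h => hex ⟨x, hx, h.2⟩).2
  · refine (hcell n hn e).imp (fun h => ⟨fun x hx => .base x (h hx), Set.disjoint_left.2
      fun x hx hx' => ?_⟩) fun h => ⟨fun x hx => .base x (h hx), Set.disjoint_left.2
      fun x hx hx' => ?_⟩
    · exact hPQ.le_bot ⟨h hx, low Q x (closedCell_subset_skeleton_one hn e hx) hx'⟩
    · exact hPQ.le_bot ⟨low P x (closedCell_subset_skeleton_one hn e hx) hx', h hx⟩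

/-- The 1-skeleton of a connected CW-complex admits no separation into unions of closed cells. -/
theorem not_separated_skeleton_one [PreconnectedSpace X] {P Q : Set X} (hPQ : Disjoint P Q)
    (hP : P ⊆ (RelCWComplex.skeleton (Set.univ : Set X) 1 : Set X))
    (hQ : Q ⊆ (RelCWComplex.skeleton (Set.univ : Set X) 1 : Set X))
    (hcell : ∀ n ≤ 1, ∀ e : RelCWComplex.cell (Set.univ : Set X) n,
      RelCWComplex.closedCell n e ⊆ P ∨ RelCWComplex.closedCell n e ⊆ Q)
    (hPne : P.Nonempty) (hQne : Q.Nonempty) : False := by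
  have key := cellHull_closedCell_dichotomy hPQ hP hQ hcell
  have hcl : ∀ R : Set X, (∀ m, ∀ j : RelCWComplex.cell (Set.univ : Set X) m,
      RelCWComplex.closedCell m j ⊆ {x | CellHull R x} ∨
      Disjoint (RelCWComplex.closedCell m j) {x | CellHull R x}) →
      IsClosed {x | CellHull R x} := by
    intro R hR
    rw [CWComplex.closed Set.univ _ (Set.subset_univ _)]
    intro m j
    rcases hR m j with h | h
    · rw [Set.inter_eq_right.2 h]; exact RelCWComplex.isClosed_closedCell
    · rw [h.symm.inter_eq]; exact isClosed_empty
  have hclP := hcl P fun m j => (key m j).imp And.left And.right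
  have hclQ := hcl Q fun m j => (key m j).symm.imp And.left And.right
  have hmem : ∀ x : X, ∃ (n : ℕ) (j : RelCWComplex.cell (Set.univ : Set X) n),
      x ∈ RelCWComplex.closedCell n j := fun x => by
    have : x ∈ (Set.univ : Set X) := trivial
    rw [← CWComplex.union (C := (Set.univ : Set X))] at this
    simpa using this
  obtain ⟨p, hp⟩ := hPne
  obtain ⟨q, hq⟩ := hQne
  obtain ⟨z, -, hz1, hz2⟩ := isPreconnected_closed_iff.1 (isPreconnected_univ (α := X)) _ _
    hclP hclQ (fun x _ => by
      obtain ⟨n, j, hx⟩ := hmem x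
      exact (key n j).imp (fun h => h.1 hx) fun h => h.1 hx)
    ⟨p, trivial, .base p hp⟩ ⟨q, trivial, .base q hq⟩
  obtain ⟨n, j, hz⟩ := hmem z
  rcases key n j with h | h
  · exact h.2.le_bot ⟨hz, hz2⟩
  · exact h.2.le_bot ⟨hz, hz1⟩

/-- Two points of a common closed cell of dimension at most one. -/
def InCommonEdge (x y : X) : Prop :=
  ∃ n ≤ 1, ∃ e : RelCWComplex.cell (Set.univ : Set X) n,
    x ∈ RelCWComplex.closedCell n e ∧ y ∈ RelCWComplex.closedCell n e

theorem exists_closedCell_of_mem_skeleton_one {x : X}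
    (hx : x ∈ (RelCWComplex.skeleton (Set.univ : Set X) 1 : Set X)) :
    ∃ n ≤ 1, ∃ e : RelCWComplex.cell (Set.univ : Set X) n, x ∈ RelCWComplex.openCell n e := by
  obtain ⟨m, hm, j, hj⟩ := CWComplex.mem_skeleton_iff.1 hx
  exact ⟨m, by exact_mod_cast hm, j, hj⟩

/-- The 1-skeleton of a connected CW-complex is connected by chains of edges. -/
theorem reflTransGen_inCommonEdge [PreconnectedSpace X] {x y : X}
    (hx : x ∈ (RelCWComplex.skeleton (Set.univ : Set X) 1 : Set X))
    (hy : y ∈ (RelCWComplex.skeleton (Set.univ : Set X) 1 : Set X)) :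
    Relation.ReflTransGen InCommonEdge x y := by
  by_contra hxy
  refine not_separated_skeleton_one
    (P := (RelCWComplex.skeleton (Set.univ : Set X) 1 : Set X) ∩
      {z | Relation.ReflTransGen InCommonEdge x z})
    (Q := (RelCWComplex.skeleton (Set.univ : Set X) 1 : Set X) ∩
      {z | ¬ Relation.ReflTransGen InCommonEdge x z})
    (Set.disjoint_left.2 fun z h h' => h'.2 h.2) Set.inter_subset_left Set.inter_subset_left
    (fun n hn e => ?_) ⟨x, hx, .refl⟩ ⟨y, hy, hxy⟩
  -- Any two points of a closed edge are one step apart, so reachability of one point forces that of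
  -- the whole edge.
  by_cases h : ∃ z ∈ RelCWComplex.closedCell n e, Relation.ReflTransGen InCommonEdge x z
  · left
    obtain ⟨z, hz, hxz⟩ := h
    exact fun w hw => ⟨closedCell_subset_skeleton_one hn e hw, hxz.tail ⟨n, hn, e, hz, hw⟩⟩
  · right
    exact fun w hw => ⟨closedCell_subset_skeleton_one hn e hw, fun h' => h ⟨w, hw, h'⟩⟩

/-- A closed cell of dimension at most one is a subcomplex. -/
theorem exists_subcomplex_eq_closedCell {n : ℕ} (hn : n ≤ 1)
    (e : RelCWComplex.cell (Set.univ : Set X) n) :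
    ∃ E : RelCWComplex.Subcomplex (Set.univ : Set X),
      (E : Set X) = RelCWComplex.closedCell n e := by
  refine ⟨CWComplex.Subcomplex.mk' Set.univ (RelCWComplex.closedCell n e)
    (fun m => {j | RelCWComplex.openCell m j ⊆ RelCWComplex.closedCell n e}) ?_ ?_, rfl⟩
  · rintro m ⟨j, hj⟩
    rw [← RelCWComplex.closure_openCell_eq_closedCell]
    exact closure_minimal hj RelCWComplex.isClosed_closedCell
  · refine Set.Subset.antisymm (Set.iUnion_subset fun m => Set.iUnion_subset fun j => j.2) ?_
    intro x hx
    have hx' := hx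
    rw [← RelCWComplex.cellFrontier_union_openCell_eq_closedCell] at hx'
    rcases hx' with hx' | hx'
    · interval_cases n
      · rw [RelCWComplex.cellFrontier_zero_eq_empty] at hx'
        exact hx'.elim
      · obtain ⟨a, b, hab⟩ := CWComplex.exists_cellFrontier_one_eq e
        have hsub := RelCWComplex.cellFrontier_subset_closedCell 1 e
        rw [hab] at hx' hsub
        rcases hx' with h | h
        · refine Set.mem_iUnion₂.2 ⟨0, ⟨a, ?_⟩, ?_⟩
          · exact (RelCWComplex.openCell_subset_closedCell 0 a).trans
              (Set.subset_union_left.trans hsub)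
          · rwa [RelCWComplex.openCell_zero_eq_singleton,
              ← RelCWComplex.closedCell_zero_eq_singleton]
        · refine Set.mem_iUnion₂.2 ⟨0, ⟨b, ?_⟩, ?_⟩
          · exact (RelCWComplex.openCell_subset_closedCell 0 b).trans
              (Set.subset_union_right.trans hsub)
          · rwa [RelCWComplex.openCell_zero_eq_singleton,
              ← RelCWComplex.closedCell_zero_eq_singleton]
    · exact Set.mem_iUnion₂.2 ⟨n, ⟨e, RelCWComplex.openCell_subset_closedCell n e⟩, hx'⟩

/-- A compact set contains only finitely many vertices. -/
theorem IsCompact.finite_inter_vertices {K : Set X} (hK : IsCompact K) :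
    (K ∩ ⋃ j : RelCWComplex.cell (Set.univ : Set X) 0, RelCWComplex.openCell 0 j).Finite := by
  -- Every set of vertices is closed, because it misses all open cells of positive dimension. The
  -- vertices in `K` thus form a compact discrete set.
  have hcl : ∀ S ⊆ ⋃ j : RelCWComplex.cell (Set.univ : Set X) 0, RelCWComplex.openCell 0 j,
      IsClosed S := fun S hS => by
    refine CWComplex.isClosed_of_disjoint_openCell_or_isClosed_inter_closedCell
      (C := Set.univ) (Set.subset_univ _) fun n hn j => Or.inl ?_
    refine Set.disjoint_of_subset_left hS (Set.disjoint_iUnion_left.2 fun i => ?_)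
    refine RelCWComplex.disjoint_openCell_of_ne fun h => ?_
    have := congrArg Sigma.fst h
    simp only at this
    omega
  refine (hK.inter_right (hcl _ subset_rfl)).finite ?_
  rw [isDiscrete_iff_forall_mem_exists_isClosed]
  exact fun t ht => ⟨t, hcl t (ht.trans Set.inter_subset_right), Set.inter_eq_left.2 ht⟩

end CellStructure

/-! ### Elementary geometry of horoballs. -/

section Horoball

variable {M : Type v} [MetricSpace M]

theorem mem_horoball {τ : GeodesicRay M} {t : ℝ} {p : M} :
    p ∈ horoball τ t ↔ ∃ l : NNReal, t ≤ (l : ℝ) ∧ dist p (τ l) ≤ (l : ℝ) - t := by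
  simp [horoball]

theorem horoball_thicken {τ : GeodesicRay M} {t D : ℝ} {p q : M} (hp : p ∈ horoball τ t)
    (hpq : dist q p ≤ D) : q ∈ horoball τ (t - D) := by
  obtain ⟨l, hl, hd⟩ := mem_horoball.1 hp
  have hD := dist_nonneg.trans hpq
  exact mem_horoball.2 ⟨l, by linarith, by linarith [dist_triangle q p (τ l)]⟩

theorem horoball_anti (τ : GeodesicRay M) {t t' : ℝ} (h : t' ≤ t) :
    horoball τ t ⊆ horoball τ t' := by
  intro p hp
  obtain ⟨l, hl, hd⟩ := mem_horoball.1 hp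
  exact mem_horoball.2 ⟨l, by linarith, by linarith⟩

theorem GeodesicRay.dist_eq (τ : GeodesicRay M) (l l' : NNReal) :
    dist (τ l) (τ l') = |(l : ℝ) - l'| := by
  rw [τ.isometry'.dist_eq, NNReal.dist_eq]

/-- Two points of a horoball lie in a common ball of the defining union. -/
theorem exists_common_ball {τ : GeodesicRay M} {t : ℝ} {p q : M} (hp : p ∈ horoball τ t)
    (hq : q ∈ horoball τ t) :
    ∃ l : NNReal, t ≤ (l : ℝ) ∧ dist p (τ l) ≤ (l : ℝ) - t ∧ dist q (τ l) ≤ (l : ℝ) - t := by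
  obtain ⟨l, hl, hd⟩ := mem_horoball.1 hp
  obtain ⟨l', hl', hd'⟩ := mem_horoball.1 hq
  -- The balls grow with `l`: shifting the centre along the ray by `l' - l` is paid for exactly by
  -- the larger radius.
  rcases le_total l l' with h | h
  · refine ⟨l', hl', ?_, hd'⟩
    have h' : (l : ℝ) ≤ l' := h
    have := τ.dist_eq l l'
    rw [abs_of_nonpos (by linarith)] at this
    linarith [dist_triangle p (τ l) (τ l')]
  · refine ⟨l, hl, hd, ?_⟩
    have h' : (l' : ℝ) ≤ l := h
    have := τ.dist_eq l' l
    rw [abs_of_nonpos (by linarith)] at this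
    linarith [dist_triangle q (τ l') (τ l)]

/-- Horoballs about the same end point, given by different rays, are nested up to a shift. -/
theorem exists_horoball_subset_of_endpoint_eq {τ σ : GeodesicRay M}
    (h : τ.endpoint = σ.endpoint) : ∃ C : ℝ, ∀ t, horoball τ t ⊆ horoball σ (t - C) := by
  obtain ⟨C, hC⟩ : τ.Asymptotic σ := Quotient.exact h
  refine ⟨C, fun t p hp => ?_⟩
  obtain ⟨l, hl, hd⟩ := mem_horoball.1 hp
  have h0 := dist_nonneg.trans (hC l)
  exact mem_horoball.2 ⟨l, by linarith, by linarith [dist_triangle p (τ l) (σ l), hC l]⟩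

end Horoball

/-! ### From paths in a Cayley graph to controlled connectivity of `X`. -/

section Control

variable {G : Type u} [Group G] {X : Type u} [TopologicalSpace X] [T2Space X]
  [CWComplex (Set.univ : Set X)] [MulAction G X]

namespace IsUniversalCoverKG1

/-- The action of `g` as a homeomorphism. -/
def homeomorph (hX : IsUniversalCoverKG1 G X) (g : G) : X ≃ₜ X where
  toEquiv := MulAction.toPerm g
  continuous_toFun := hX.continuous_smul g
  continuous_invFun := hX.continuous_smul g⁻¹

theorem exists_image_closedCell_eq (hX : IsUniversalCoverKG1 G X) (g : G) (n : ℕ)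
    (i : RelCWComplex.cell (Set.univ : Set X) n) :
    ∃ j : RelCWComplex.cell (Set.univ : Set X) n,
      (fun x : X => g • x) '' RelCWComplex.closedCell n i = RelCWComplex.closedCell n j := by
  obtain ⟨j, hj⟩ := hX.smul_openCell g n i
  refine ⟨j, ?_⟩
  rw [← RelCWComplex.closure_openCell_eq_closedCell, ← RelCWComplex.closure_openCell_eq_closedCell,
    ← hj]
  exact (hX.homeomorph g).image_closure _

end IsUniversalCoverKG1

variable {M : Type v} [MetricSpace M] {ρ : G →* (M ≃ᵢ M)} {h : X → M} {τ : GeodesicRay M}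

/-- With `exists_closedCell_of_mem_horoballSubcomplex`, this makes the subcomplex the union of the
closed cells of dimension at most one that `h` maps into the horoball. -/
theorem closedCell_subset_horoballSubcomplex {t : ℝ} {n : ℕ} (hn : n ≤ 1)
    {e : RelCWComplex.cell (Set.univ : Set X) n}
    (he : RelCWComplex.closedCell n e ⊆ h ⁻¹' horoball τ t) :
    RelCWComplex.closedCell n e ⊆ horoballSubcomplex h τ t := by
  obtain ⟨E, hE⟩ := exists_subcomplex_eq_closedCell hn e
  intro x hx
  refine Set.mem_iUnion₂.2 ⟨E, ?_, hE ▸ hx⟩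
  rw [hE]
  exact Set.subset_inter (closedCell_subset_skeleton_one hn e) he

theorem exists_closedCell_of_mem_horoballSubcomplex {t : ℝ} {x : X}
    (hx : x ∈ horoballSubcomplex h τ t) :
    ∃ n ≤ 1, ∃ e : RelCWComplex.cell (Set.univ : Set X) n,
      x ∈ RelCWComplex.closedCell n e ∧ RelCWComplex.closedCell n e ⊆ h ⁻¹' horoball τ t := by
  obtain ⟨E, hE, hxE⟩ := Set.mem_iUnion₂.1 hx
  have hxE' := hxE
  rw [← CWComplex.Subcomplex.union_closedCell] at hxE'
  obtain ⟨n, ⟨j, hj⟩, hxj⟩ := Set.mem_iUnion₂.1 hxE'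
  have hsub := RelCWComplex.Subcomplex.closedCell_subset_of_mem E hj
  refine ⟨n, ?_, j, hxj, hsub.trans (hE.trans Set.inter_subset_right)⟩
  by_contra hn
  -- The centre of a cell of dimension at least two lies outside the 1-skeleton.
  exact (RelCWComplex.disjoint_skeleton_openCell (n := 1) (m := n) (j := j)
    (by exact_mod_cast not_le.1 hn)).le_bot
    ⟨(hE (hsub (RelCWComplex.map_zero_mem_closedCell n j))).1,
      RelCWComplex.map_zero_mem_openCell n j⟩

theorem horoballSubcomplex_anti (h : X → M) (τ : GeodesicRay M) {t t' : ℝ} (ht : t' ≤ t) :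
    horoballSubcomplex h τ t ⊆ horoballSubcomplex h τ t' := by
  intro x hx
  obtain ⟨n, hn, e, hxe, he⟩ := exists_closedCell_of_mem_horoballSubcomplex hx
  exact closedCell_subset_horoballSubcomplex hn
    (he.trans (Set.preimage_mono (horoball_anti τ ht))) hxe

/-- Translates of a pair of points on an edge are joined at bounded depth. -/
theorem InCommonEdge.exists_joinedIn (hX : IsUniversalCoverKG1 G X) (hh : IsControlMap ρ X h)
    (τ : GeodesicRay M) (p₀ : M) {x y : X} (hxy : InCommonEdge x y) :
    ∃ D : ℝ, 0 ≤ D ∧ ∀ (g : G) (t : ℝ), ρ g p₀ ∈ horoball τ t →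
      JoinedIn (horoballSubcomplex h τ (t - D)) (g • x) (g • y) := by
  obtain ⟨n, hn, e, hx, hy⟩ := hxy
  have hsk := closedCell_subset_skeleton_one hn e
  -- `D` bounds the image of one edge around `p₀`. By equivariance the same `D` works for every
  -- translate.
  have hcpt : IsCompact (h '' RelCWComplex.closedCell n e) :=
    RelCWComplex.isCompact_closedCell.image_of_continuousOn (hh.continuousOn.mono hsk)
  obtain ⟨D, hD⟩ := hcpt.isBounded.subset_closedBall p₀
  refine ⟨D, dist_nonneg.trans (hD ⟨x, hx, rfl⟩), fun g t hg => ?_⟩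
  obtain ⟨j, hj⟩ := hX.exists_image_closedCell_eq g n e
  have hsub : RelCWComplex.closedCell n j ⊆ h ⁻¹' horoball τ (t - D) := by
    rw [← hj]
    rintro _ ⟨z, hz, rfl⟩
    refine horoball_thicken hg ?_
    change dist (h (g • z)) _ ≤ D
    rw [hh.equivariant g z (hsk hz), (ρ g).isometry.dist_eq]
    exact hD ⟨z, hz, rfl⟩
  refine ((isPathConnected_closedCell n j).joinedIn _ ?_ _ ?_).mono
    (closedCell_subset_horoballSubcomplex hn hsub) <;> rw [← hj]
  · exact ⟨x, hx, rfl⟩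
  · exact ⟨y, hy, rfl⟩

/-- Translates of a pair of points of the 1-skeleton are joined at bounded depth. -/
theorem exists_joinedIn_smul (hX : IsUniversalCoverKG1 G X) (hh : IsControlMap ρ X h)
    (τ : GeodesicRay M) (p₀ : M) {x y : X}
    (hx : x ∈ (RelCWComplex.skeleton (Set.univ : Set X) 1 : Set X))
    (hy : y ∈ (RelCWComplex.skeleton (Set.univ : Set X) 1 : Set X)) :
    ∃ D : ℝ, 0 ≤ D ∧ ∀ (g : G) (t : ℝ), ρ g p₀ ∈ horoball τ t →
      JoinedIn (horoballSubcomplex h τ (t - D)) (g • x) (g • y) := by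
  have := hX.contractible
  induction reflTransGen_inCommonEdge hx hy with
  | refl =>
    obtain ⟨n, hn, e, he⟩ := exists_closedCell_of_mem_skeleton_one hx
    have he' := RelCWComplex.openCell_subset_closedCell n e he
    exact InCommonEdge.exists_joinedIn hX hh τ p₀ ⟨n, hn, e, he', he'⟩
  | @tail b c hab hbc ih =>
    obtain ⟨D, hD0, hD⟩ := ih (by
      obtain ⟨n, hn, e, hb, -⟩ := hbc
      exact closedCell_subset_skeleton_one hn e hb)
    obtain ⟨D', hD0', hD'⟩ := hbc.exists_joinedIn hX hh τ p₀
    refine ⟨max D D', le_max_of_le_left hD0, fun g t hg => ?_⟩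
    exact ((hD g t hg).mono (horoballSubcomplex_anti h τ (by linarith [le_max_left D D']))).trans
      ((hD' g t hg).mono (horoballSubcomplex_anti h τ (by linarith [le_max_right D D'])))

/-- Every point of `X_(τ,t)` is joined, at bounded depth, to a translate of the base vertex. -/
theorem exists_joinedIn_translate (hX : IsUniversalCoverKG1 G X) (hh : IsControlMap ρ X h)
    (τ : GeodesicRay M) (p₀ : M) {x₀ : X}
    (hx₀ : x₀ ∈ (RelCWComplex.skeleton (Set.univ : Set X) 1 : Set X)) :
    ∃ D : ℝ, 0 ≤ D ∧ ∀ (t : ℝ), ∀ x ∈ horoballSubcomplex h τ t, ∃ g : G,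
      ρ g p₀ ∈ horoball τ (t - D) ∧ JoinedIn (horoballSubcomplex h τ (t - D)) x (g • x₀) := by
  obtain ⟨K, hK, hKs⟩ := hX.cocompact
  have hKsub : K ⊆ (RelCWComplex.skeleton (Set.univ : Set X) 1 : Set X) := by
    rw [hKs]
    exact fun k hk => Set.mem_iUnion.2 ⟨1, k, hk, one_smul G k⟩
  -- The bound `D k` chosen below need not be bounded over `K`. Moving first to a vertex of the edge
  -- leaves only finitely many `k`.
  have hfin := hK.finite_inter_vertices
  have hbd : ∀ k ∈ K, ∃ D : ℝ, 0 ≤ D ∧ dist p₀ (h k) ≤ D ∧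
      ∀ (g : G) (t : ℝ), ρ g p₀ ∈ horoball τ t →
        JoinedIn (horoballSubcomplex h τ (t - D)) (g • k) (g • x₀) := by
    intro k hk
    obtain ⟨D, hD0, hD⟩ := exists_joinedIn_smul hX hh τ p₀ (hKsub hk) hx₀
    refine ⟨max D (dist p₀ (h k)), le_max_of_le_left hD0, le_max_right _ _, fun g t hg => ?_⟩
    exact (hD g t hg).mono (horoballSubcomplex_anti h τ (by linarith [le_max_left D (dist p₀ (h k))]))
  choose! D hD0 hDd hD using hbd
  obtain ⟨D', hD'⟩ := (hfin.image D).bddAbove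
  have hle : ∀ k ∈ K ∩ ⋃ j : RelCWComplex.cell (Set.univ : Set X) 0, RelCWComplex.openCell 0 j,
      D k ≤ max D' 0 := fun k hk => (hD' ⟨k, hk, rfl⟩).trans (le_max_left _ _)
  -- One summand brings `ρ g p₀` into the horoball, the other joins `g • k` to `g • x₀`.
  refine ⟨max D' 0 + max D' 0, by positivity, fun t x hx => ?_⟩
  have hm : 0 ≤ max D' 0 := le_max_right _ _
  obtain ⟨n, hn, e, hxe, he⟩ := exists_closedCell_of_mem_horoballSubcomplex hx
  obtain ⟨j, hj⟩ := exists_vertex_mem_closedCell hn e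
  obtain ⟨v, hv⟩ := RelCWComplex.openCell_nonempty 0 j
  have hvs := closedCell_subset_skeleton_one hn e (hj hv)
  rw [hKs] at hvs
  obtain ⟨g, k, hk, hgk⟩ := Set.mem_iUnion.1 hvs
  have hkv : k ∈ ⋃ j : RelCWComplex.cell (Set.univ : Set X) 0, RelCWComplex.openCell 0 j := by
    obtain ⟨i, hi⟩ := hX.smul_openCell g⁻¹ 0 j
    refine Set.mem_iUnion.2 ⟨i, hi ▸ ⟨v, hv, ?_⟩⟩
    rw [← hgk]
    exact inv_smul_smul g k
  have hg : ρ g p₀ ∈ horoball τ (t - max D' 0) := by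
    refine horoball_thicken (he (hj hv)) ?_
    rw [← hgk, hh.equivariant g k (hKsub hk), (ρ g).isometry.dist_eq]
    exact (hDd k hk).trans (hle k ⟨hk, hkv⟩)
  refine ⟨g, horoball_anti τ (by linarith) hg, ?_⟩
  have h1 : JoinedIn (horoballSubcomplex h τ t) x v :=
    ((isPathConnected_closedCell n e).joinedIn x hxe v (hj hv)).mono
      (closedCell_subset_horoballSubcomplex hn he)
  have h2 := hD k hk g _ hg
  rw [show g • k = v from hgk] at h2
  exact (h1.mono (horoballSubcomplex_anti h τ (by linarith))).trans
    (h2.mono (horoballSubcomplex_anti h τ (by linarith [hle k ⟨hk, hkv⟩])))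

/-- An edge of the Cayley graph of `G` with respect to `S` whose ends are mapped to the horoball
`HB_t(τ)` by the orbit map of `p₀`. -/
def HoroballStep (ρ : G →* (M ≃ᵢ M)) (p₀ : M) (τ : GeodesicRay M) (S : Set G) (t : ℝ)
    (g g' : G) : Prop :=
  ρ g p₀ ∈ horoball τ t ∧ ρ g' p₀ ∈ horoball τ t ∧ ∃ s ∈ S, g' = g * s

/-- Controlled connectivity can be read off from a Cayley graph. -/
theorem isControlledConnected_of_eqvGen (hX : IsUniversalCoverKG1 G X) (hh : IsControlMap ρ X h)
    (τ : GeodesicRay M) (p₀ : M) {S : Set G} (hS : S.Finite) {C : ℝ} (hC : 0 ≤ C)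
    (H : ∀ (t : ℝ) (g g' : G), ρ g p₀ ∈ horoball τ t → ρ g' p₀ ∈ horoball τ t →
      Relation.EqvGen (HoroballStep ρ p₀ τ S (t - C)) g g') :
    IsControlledConnected h τ := by
  have := hX.contractible
  -- The frontier of a cell of positive dimension is nonempty and covered by lower cells, so one
  -- descends to a vertex.
  obtain ⟨x₀, hx₀⟩ : ∃ x₀ : X, x₀ ∈ (RelCWComplex.skeleton (Set.univ : Set X) 1 : Set X) := by
    obtain ⟨x⟩ : Nonempty X := inferInstance
    have hx : x ∈ (Set.univ : Set X) := trivial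
    rw [← CWComplex.union (C := (Set.univ : Set X))] at hx
    obtain ⟨n, e, -⟩ := Set.mem_iUnion₂.1 hx
    clear hx
    induction n using Nat.strong_induction_on with
    | _ n ih =>
      rcases Nat.eq_zero_or_pos n with rfl | hn
      · exact ⟨_, closedCell_subset_skeleton_one zero_le_one e
          (RelCWComplex.map_zero_mem_closedCell 0 e)⟩
      · obtain ⟨I, hI⟩ := CWComplex.cellFrontier_subset_finite_closedCell n e
        obtain ⟨y, hy⟩ := RelCWComplex.nonempty_cellFrontier hn.ne' e
        obtain ⟨m, hm, j, -, -⟩ := by simpa using hI hy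
        exact ih m hm j
  obtain ⟨D, hD0, hD⟩ := exists_joinedIn_translate hX hh τ p₀ hx₀
  have hsk : ∀ g : G, g • x₀ ∈ (RelCWComplex.skeleton (Set.univ : Set X) 1 : Set X) := fun g => by
    obtain ⟨n, hn, e, he⟩ := exists_closedCell_of_mem_skeleton_one hx₀
    obtain ⟨j, hj⟩ := hX.smul_openCell g n e
    exact closedCell_subset_skeleton_one hn j
      (RelCWComplex.openCell_subset_closedCell n j (hj ▸ ⟨x₀, he, rfl⟩))
  choose E hE0 hE using fun s : G => exists_joinedIn_smul hX hh τ p₀ hx₀ (hsk s)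
  -- Including `1` gives `0 ≤ E'`, and later shows that `g • x₀` lies in the subcomplex when `g =
  -- g'`.
  obtain ⟨E', hE'⟩ := ((hS.insert 1).image E).bddAbove
  have hE1 : E 1 ≤ E' := hE' ⟨1, Set.mem_insert _ _, rfl⟩
  have hE'0 : 0 ≤ E' := (hE0 1).trans hE1
  -- Reflexivity of `EqvGen` carries no horoball condition, hence the separate alternative `g = g'`.
  have hstep : ∀ (u : ℝ) (g g' : G), Relation.EqvGen (HoroballStep ρ p₀ τ S u) g g' →
      g = g' ∨ JoinedIn (horoballSubcomplex h τ (u - E')) (g • x₀) (g' • x₀) := by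
    intro u g g' hgg'
    induction hgg' with
    | rel g g' hr =>
      obtain ⟨h1, -, s, hs, rfl⟩ := hr
      right
      have := hE s g u h1
      rw [smul_smul] at this
      exact this.mono (horoballSubcomplex_anti h τ
        (by linarith [hE' ⟨s, Set.mem_insert_of_mem _ hs, rfl⟩]))
    | refl g => exact Or.inl rfl
    | symm g g' _ ih => exact ih.imp Eq.symm JoinedIn.symm
    | trans a b c _ _ ih1 ih2 =>
      rcases ih1 with rfl | ih1
      · exact ih2
      · rcases ih2 with rfl | ih2
        · exact Or.inr ih1
        · exact Or.inr (ih1.trans ih2)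
  -- `D` moves points to translates of `x₀`, `C` is lost in the Cayley graph, and `E'` in realizing
  -- its edges in `X`.
  refine ⟨fun _ => D + C + E', fun _ => by positivity, fun t x hx y hy => ?_,
    Filter.tendsto_atTop_add_const_right _ _ Filter.tendsto_id⟩
  obtain ⟨g, hg, hxg⟩ := hD t x hx
  obtain ⟨g', hg', hyg'⟩ := hD t y hy
  have hgg' : JoinedIn (horoballSubcomplex h τ (t - (D + C + E'))) (g • x₀) (g' • x₀) := by
    rcases hstep _ g g' (H _ g g' hg hg') with rfl | hj
    · have := hE 1 g _ hg
      rw [one_smul] at this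
      exact (JoinedIn.refl this.source_mem).mono (horoballSubcomplex_anti h τ (by linarith))
    · exact hj.mono (horoballSubcomplex_anti h τ (by linarith))
  exact ((hxg.mono (horoballSubcomplex_anti h τ (by linarith))).trans hgg').trans
    (hyg'.mono (horoballSubcomplex_anti h τ (by linarith))).symm

end Control

/-! ### Vertices in the geometric realization. -/

section VertexDistance

variable {V : Type v} {Γ : SimpleGraph V} [Fact Γ.Connected]

theorem dist_vertexPoint (x y : V) :
    dist (vertexPoint Γ x) (vertexPoint Γ y) = (Γ.dist x y : ℝ) := by
  change EdgePoint.pathDist _ _ = _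
  by_cases h : x = y
  · subst h
    simp [EdgePoint.pathDist]
  · simp [EdgePoint.pathDist, EdgePoint.detour, h]

/-- Every point of the realization is at distance at most one from a vertex. -/
theorem exists_dist_vertexPoint_le_one (p : GeometricRealization Γ) :
    ∃ x : V, dist p (vertexPoint Γ x) ≤ 1 := by
  obtain ⟨p, rfl⟩ := SeparationQuotient.surjective_mk p
  refine ⟨p.src, ?_⟩
  change EdgePoint.pathDist p _ ≤ 1
  refine (EdgePoint.pathDist_le_detour _ _).trans
    ((EdgePoint.detour_le _ _ (Or.inl ⟨rfl, rfl⟩) (Or.inl ⟨rfl, rfl⟩)).trans ?_)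
  have h := p.pos_le
  rcases p.eq_or_adj with he | he
  · rw [he, SimpleGraph.dist_self] at h
    simp only [SimpleGraph.dist_self, Nat.cast_zero] at h ⊢
    linarith
  · rw [SimpleGraph.dist_eq_one_iff_adj.2 he] at h
    simp only [SimpleGraph.dist_self, Nat.cast_zero, Nat.cast_one] at h ⊢
    linarith

end VertexDistance

/-! ### Generation of the kernel `B`. -/

section Semidirect

variable {A : Type u} [Group A] {B : Type v} [Group B] {φ : A →* MulAut B}

/-- If `B ⋊ A` is finitely generated, then `B` is generated by the `A`-orbits of finitely many
elements. -/
theorem exists_finite_closure_orbits_eq_top (hG : Group.FG (B ⋊[φ] A)) :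
    ∃ S : Set B, S.Finite ∧ Subgroup.closure {x | ∃ a : A, ∃ s ∈ S, x = φ a s} = ⊤ := by
  obtain ⟨F, hF, hFfin⟩ := Group.fg_iff.1 hG
  refine ⟨SemidirectProduct.left '' F, hFfin.image _, ?_⟩
  set N := Subgroup.closure {x | ∃ a : A, ∃ s ∈ SemidirectProduct.left '' F, x = φ a s} with hN
  have hinv : ∀ (a : A), ∀ x ∈ N, φ a x ∈ N := by
    intro a x hx
    induction hx using Subgroup.closure_induction with
    | mem x hx =>
      obtain ⟨c, s, hs, rfl⟩ := hx
      exact Subgroup.subset_closure ⟨a * c, s, hs, by simp⟩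
    | one => simp [N.one_mem]
    | mul x y _ _ hx hy => rw [map_mul]; exact N.mul_mem hx hy
    | inv x _ hx => rw [map_inv]; exact N.inv_mem hx
  -- The left component of `x * y` is `x.left * φ x.right y.left`, so invariance of `N` under `φ` is
  -- what closes the induction.
  have hleft : ∀ g : B ⋊[φ] A, g.left ∈ N := by
    intro g
    have hg : g ∈ Subgroup.closure F := hF ▸ Subgroup.mem_top g
    induction hg using Subgroup.closure_induction with
    | mem x hx => exact Subgroup.subset_closure ⟨1, x.left, ⟨x, hx, rfl⟩, by simp⟩
    | one => exact N.one_mem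
    | mul x y _ _ hx hy =>
      rw [SemidirectProduct.mul_left]
      exact N.mul_mem hx (hinv _ _ hy)
    | inv x _ hx =>
      rw [SemidirectProduct.inv_left]
      exact hinv _ _ (N.inv_mem hx)
  exact (Subgroup.eq_top_iff' N).2 fun x => hleft (SemidirectProduct.inl x)

end Semidirect

/-! ### Walking in the Cayley graph of `B ⋊ A` over a horoball. -/

section Main

variable {ι : Type w} {A : Type u} [Group A] (b : FreeGroupBasis ι A)
  {B : Type v} [Group B] (φ : A →* MulAut B)

theorem semidirectTreeAction_vertexPoint_one (g : B ⋊[φ] A) :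
    semidirectTreeAction φ b g (vertexPoint (cayleyGraph b) 1) =
      vertexPoint (cayleyGraph b) g.right := by
  change SeparationQuotient.mk _ = SeparationQuotient.mk _
  congr 1
  change EdgePoint.mk (g.right * 1) (g.right * 1) _ _ _ _ = EdgePoint.mk _ _ _ _ _ _
  simp only [mul_one]

variable {b φ} {σ : GeodesicRay (CayleyTree b)} {S : Set (B ⋊[φ] A)} {t : ℝ}

theorem horoballStep_iff {g g' : B ⋊[φ] A} :
    HoroballStep (semidirectTreeAction φ b) (vertexPoint (cayleyGraph b) 1) σ S t g g' ↔
      vertexPoint (cayleyGraph b) g.right ∈ horoball σ t ∧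
      vertexPoint (cayleyGraph b) g'.right ∈ horoball σ t ∧ ∃ s ∈ S, g' = g * s := by
  rw [HoroballStep, semidirectTreeAction_vertexPoint_one, semidirectTreeAction_vertexPoint_one]

/-- Since `φ a 1 = 1`, multiplying by `inr (b i)` leaves the `B`-component alone, so walks in the
tree lift. Edges traversed backwards use the symmetry of `EqvGen`. -/
theorem eqvGen_horoballStep_of_walk (hS : ∀ i, SemidirectProduct.inr (b i) ∈ S) (x : B) {a a' : A}
    (p : (cayleyGraph b).Walk a a')
    (hp : ∀ c ∈ p.support, vertexPoint (cayleyGraph b) c ∈ horoball σ t) :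
    Relation.EqvGen (HoroballStep (semidirectTreeAction φ b) (vertexPoint (cayleyGraph b) 1) σ S t)
      ⟨x, a⟩ ⟨x, a'⟩ := by
  induction p with
  | nil => exact .refl _
  | @cons a c a' hadj p ih =>
    refine .trans _ _ _ ?_ (ih fun d hd => hp d (by simp [hd]))
    have ha : vertexPoint (cayleyGraph b) a ∈ horoball σ t := hp a (by simp)
    have hc : vertexPoint (cayleyGraph b) c ∈ horoball σ t := hp c (by simp)
    obtain ⟨-, s, ⟨i, rfl⟩, h | h⟩ := (SimpleGraph.mulCayley_adj' _ _ _).1 hadj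
    · refine .rel _ _ (horoballStep_iff.2 ⟨ha, hc, _, hS i, ?_⟩)
      ext <;> simp [h]
    · refine .symm _ _ (.rel _ _ (horoballStep_iff.2 ⟨hc, ha, _, hS i, ?_⟩))
      ext <;> simp [h]

/-- Two vertices of a horoball are joined by a path of vertices in a slightly larger horoball. -/
theorem eqvGen_horoballStep_right (hS : ∀ i, SemidirectProduct.inr (b i) ∈ S) (x : B) {a a' : A}
    (ha : vertexPoint (cayleyGraph b) a ∈ horoball σ t)
    (ha' : vertexPoint (cayleyGraph b) a' ∈ horoball σ t) :
    Relation.EqvGen (HoroballStep (semidirectTreeAction φ b) (vertexPoint (cayleyGraph b) 1) σ S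
      (t - 2)) ⟨x, a⟩ ⟨x, a'⟩ := by
  classical
  obtain ⟨l, hl, hd, hd'⟩ := exists_common_ball ha ha'
  -- The centre `σ l` need not be a vertex. Going through a vertex `w` within distance 1 costs 1 in
  -- the length of the geodesic to `c` and 1 in comparing with `σ l`, hence the shift by 2.
  obtain ⟨w, hw⟩ := exists_dist_vertexPoint_le_one (σ l)
  have key : ∀ c : A, dist (vertexPoint (cayleyGraph b) c) (σ l) ≤ l - t →
      Relation.EqvGen (HoroballStep (semidirectTreeAction φ b) (vertexPoint (cayleyGraph b) 1) σ S
        (t - 2)) ⟨x, w⟩ ⟨x, c⟩ := by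
    intro c hc
    obtain ⟨p, hp⟩ := (cayleyGraph_connected b).exists_walk_length_eq_dist w c
    refine eqvGen_horoballStep_of_walk hS x p fun d hdp => mem_horoball.2 ⟨l, by linarith, ?_⟩
    have h1 : ((cayleyGraph b).dist w d : ℝ) ≤ (cayleyGraph b).dist w c := by
      rw [← hp]
      exact_mod_cast (SimpleGraph.dist_le (p.takeUntil d hdp)).trans (p.length_takeUntil_le_length hdp)
    rw [← dist_vertexPoint, ← dist_vertexPoint] at h1
    rw [dist_comm] at hc
    rw [dist_comm] at hw
    have h2 := dist_triangle (vertexPoint (cayleyGraph b) d) (vertexPoint (cayleyGraph b) w) (σ l)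
    have h3 := dist_triangle (vertexPoint (cayleyGraph b) w) (σ l) (vertexPoint (cayleyGraph b) c)
    rw [dist_comm (vertexPoint (cayleyGraph b) d) (vertexPoint (cayleyGraph b) w)] at h2
    linarith
  exact .trans _ _ _ (.symm _ _ (key a hd)) (key a' hd')

/-- The core of the argument: a factor `φ c s` is inserted over a vertex `a'` of the horoball with
`φ a' = φ c`. Each such detour starts and ends over `HB_t` itself, so the loss of 2 does not
accumulate over long products. -/
theorem eqvGen_horoballStep (hS : ∀ i, SemidirectProduct.inr (b i) ∈ S) {F : Set B}
    (hF : Subgroup.closure {x | ∃ a : A, ∃ s ∈ F, x = φ a s} = ⊤)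
    (hFS : ∀ s ∈ F, SemidirectProduct.inl s ∈ S)
    (hσ : ∀ a : A, ∃ a' : A, vertexPoint (cayleyGraph b) a' ∈ horoball σ t ∧ φ a' = φ a)
    {g g' : B ⋊[φ] A} (hg : vertexPoint (cayleyGraph b) g.right ∈ horoball σ t)
    (hg' : vertexPoint (cayleyGraph b) g'.right ∈ horoball σ t) :
    Relation.EqvGen (HoroballStep (semidirectTreeAction φ b) (vertexPoint (cayleyGraph b) 1) σ S
      (t - 2)) g g' := by
  have hB : ∀ y : B, ∀ (x : B) (a : A), vertexPoint (cayleyGraph b) a ∈ horoball σ t →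
      Relation.EqvGen (HoroballStep (semidirectTreeAction φ b) (vertexPoint (cayleyGraph b) 1) σ S
        (t - 2)) ⟨x, a⟩ ⟨x * y, a⟩ := by
    intro y
    have hy : y ∈ Subgroup.closure {x | ∃ a : A, ∃ s ∈ F, x = φ a s} := hF ▸ Subgroup.mem_top y
    induction hy using Subgroup.closure_induction with
    | mem y hy =>
      obtain ⟨c, s, hs, rfl⟩ := hy
      intro x a ha
      obtain ⟨a', ha', hφ⟩ := hσ c
      have hm := horoball_anti σ (show t - 2 ≤ t by linarith) ha'
      refine .trans _ _ _ (eqvGen_horoballStep_right hS x ha ha') (.trans _ _ _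
        (.rel _ _ (horoballStep_iff.2 ⟨hm, hm, _, hFS s hs, ?_⟩))
        (eqvGen_horoballStep_right hS (x * φ c s) ha' ha))
      ext <;> simp [hφ]
    | one => intro x a _; rw [mul_one]; exact .refl _
    | mul y z _ _ hy hz =>
      intro x a ha
      rw [← mul_assoc]
      exact .trans _ _ _ (hy x a ha) (hz (x * y) a ha)
    | inv y _ hy =>
      intro x a ha
      -- The inverse is the step for `y` started at `x * y⁻¹` and read backwards, which is why the
      -- induction keeps `x` general.
      have := hy (x * y⁻¹) a ha
      rw [inv_mul_cancel_right] at this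
      exact .symm _ _ this
  obtain ⟨x, a⟩ := g
  obtain ⟨x', a'⟩ := g'
  have := hB (x⁻¹ * x') x a hg
  rw [mul_inv_cancel_left] at this
  exact .trans _ _ _ this (eqvGen_horoballStep_right hS x' hg hg')

end Main

theorem mainTheorem5 {ι : Type w} [Finite ι] {A : Type u} [Group A] (b : FreeGroupBasis ι A)
    {B : Type v} [Group B] (φ : A →* MulAut B) (hG : Group.FG (B ⋊[φ] A))
    (τ : GeodesicRay (CayleyTree b))
    (hτ : ∀ k : ℤ, 0 ≤ k → φ '' horoballVertices b τ k = Set.range φ) :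
    τ.endpoint ∈ SigmaOne (semidirectTreeAction φ b) := by
  intro X _ _ _ _ hX h hh σ hσ
  obtain ⟨F, hFfin, hF⟩ := exists_finite_closure_orbits_eq_top hG
  -- The hypothesis concerns `τ`, but the condition must hold for every ray `σ` with its end point.
  -- Horoballs of `τ` are needed inside those of `σ`.
  obtain ⟨C, hC⟩ := exists_horoball_subset_of_endpoint_eq hσ.symm
  refine isControlledConnected_of_eqvGen hX hh σ (vertexPoint (cayleyGraph b) 1)
    (S := (Set.range fun i => SemidirectProduct.inr (b i)) ∪ SemidirectProduct.inl '' F)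
    ((Set.finite_range _).union (hFfin.image _)) (zero_le_two (α := ℝ)) ?_
  intro t g g' hg hg'
  rw [semidirectTreeAction_vertexPoint_one] at hg hg'
  refine eqvGen_horoballStep (fun i => Or.inl ⟨i, rfl⟩) hF (fun s hs => Or.inr ⟨s, hs, rfl⟩)
    (fun a => ?_) hg hg'
  -- An integer `k ≥ t + C` makes `HB_k(τ)` lie in `HB_t(σ)`. The maximum with `0` keeps `k` in the
  -- range of the hypothesis when `t + C` is negative.
  have ha : φ a ∈ φ '' horoballVertices b τ (max 0 ⌈t + C⌉) := by
    rw [hτ _ (le_max_left _ _)]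
    exact ⟨a, rfl⟩
  obtain ⟨a', ha', hφ⟩ := ha
  refine ⟨a', horoball_anti σ ?_ (hC _ ha'), hφ⟩
  have : t + C ≤ ((max 0 ⌈t + C⌉ : ℤ) : ℝ) :=
    (Int.le_ceil _).trans (by exact_mod_cast le_max_right _ _)
  linarith
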